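/- All graphs are finite and simple. For a graph $G$ and $S\subseteq V(G)$ let $c(G-S)$ be the number of components of the graph obtained from $G$ by deleting $S$; for a real number $t\ge 0$, $G$ is called $t$-tough if $|S|\ge t\cdot c(G-S)$ for every $S\subseteq V(G)$ with $c(G-S)\ge 2$. A $k$-tree is a tree with maximum degree at most $k$, and a $k$-walk is a closed walk that visits each vertex at most $k$ times, where the coinciding first and last vertex of the walk are counted as one visit; a walk is spanning if it visits every vertex. Let $k\ge 2$ be an integer, and let $G$ be a connected graph that has no $K_4$ minor and is $\frac{1}{k-1}$-tough. Then for every vertex $x\in V(G)$, $G$ has a spanning tree $T$ such that $d_T(v)\le k$ for all $v\in V(G)$ and $d_T(x)\le k-1$. Consequently $G$ has a spanning $k$-tree, and $G$ has a spanning $k$-walk. (The last assertion is the Jackson–Wormald conjecture, that every connected $\frac{1}{k-1}$-tough graph has a spanning $k$-walk, for $K_4$-minor-free graphs.) -/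

import Mathlib

namespace SimpleGraph

/-- The number `c(G - S)` of components of the graph obtained from `G` by deleting the
vertices in `S`. -/
noncomputable def numComponentsDelete {V : Type*} (G : SimpleGraph V) (S : Finset V) : ℕ :=
  Nat.card (G.induce ((S : Set V)ᶜ)).ConnectedComponent

/-- The finite graph `G` is `t`-tough: `|S| ≥ t * c(G - S)` for each set `S` of vertices with
`c(G - S) ≥ 2`. -/
def IsTough {V : Type*} (G : SimpleGraph V) (t : ℝ) : Prop :=
  ∀ S : Finset V, 2 ≤ G.numComponentsDelete S → t * (G.numComponentsDelete S : ℝ) ≤ (S.card : ℝ)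

/-- `H` is a minor of `G`: there are pairwise disjoint sets of vertices of `G`, one for each vertex
of `H`, each inducing a (nonempty) connected subgraph of `G`, such that adjacent vertices of `H`
have sets joined by an edge of `G`. Contracting these sets to single vertices, and deleting
superfluous vertices and edges, turns `G` into a copy of `H`. -/
def IsMinor {W V : Type*} (H : SimpleGraph W) (G : SimpleGraph V) : Prop :=
  ∃ B : W → Set V,
    (∀ w, (G.induce (B w)).Connected) ∧
    (∀ w w', w ≠ w' → Disjoint (B w) (B w')) ∧
    (∀ w w', H.Adj w w' → ∃ a ∈ B w, ∃ b ∈ B w', G.Adj a b)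

/-- `G` is `K₄`-minor-free. -/
def IsK4MinorFree {V : Type*} (G : SimpleGraph V) : Prop :=
  ¬ (completeGraph (Fin 4)).IsMinor G

/-- `T` is a spanning tree of `G`; both graphs have vertex set `V`. -/
def IsSpanningTree {V : Type*} (T G : SimpleGraph V) : Prop :=
  T ≤ G ∧ T.IsTree

/-- `T` is a `k`-tree in the sense of a tree with maximum degree at most `k`. -/
def IsKTree {V : Type*} [Fintype V] (T : SimpleGraph V) [DecidableRel T.Adj] (k : ℕ) : Prop :=
  T.IsTree ∧ ∀ v, T.degree v ≤ k

/-- The closed walk `p` is a `k`-walk: each vertex occurs at most `k` times on it. The common first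
and last vertex is the same place of the closed walk, so the first entry of the
support is not counted. -/
def Walk.IsKWalk {V : Type*} [DecidableEq V] {G : SimpleGraph V} {u : V} (p : G.Walk u u)
    (k : ℕ) : Prop :=
  ∀ v, p.support.tail.count v ≤ k

/-- The walk `p` is spanning: it visits every vertex. -/
def Walk.IsSpanningWalk {V : Type*} {G : SimpleGraph V} {u w : V} (p : G.Walk u w) : Prop :=
  ∀ v, v ∈ p.support

end SimpleGraph

/-! Rooted at x, the tree has the required degrees once every vertex has at most k - 1 children. A
K₄-minor-free graph has, besides any prescribed root r, a vertex s with at most two neighbours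
(`isMinor_completeGraph_of_forall_not_nbrsInPair`). Contracting s into a neighbour allows induction,
provided the statement remembers what was contracted.

The stronger statement gives each vertex a capacity g a and each pair a demand m a b, to be paid in
tokens by a and b. An arc from a to b needs a token of a towards b, which also counts towards m a b.
Toughness becomes: the demand inside S plus the number of components of B - S is at most the
capacity of S (plus 1 if S is empty). `TokenTough` doubles this, because its sum runs over ordered
pairs.

If s has the single neighbour u, then u pays what s cannot cover, and at least 1 for the arc to s:
max 1 (m u s - g s). If s has neighbours u and t, they are forced to pay m u s - g s and m t s - g
s. The rest of max 1 (m u s + m t s - g s) can be shared between them and becomes extra demand on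
the pair u, t. Toughness for S and for S ∪ {s} makes the smaller instance tough (`mergeInto_leaf`,
`mergeInto_degree_two`), and its solution lifts back (`exists_arborescence_of_leaf`,
`exists_arborescence_of_degree_two`). Zero demand and capacity k - 1 give the tree, and a walk
around the tree is the k-walk. -/

namespace SimpleGraph

/-! ### Contractions and K₄ minors -/

/-- The graph obtained by merging the vertex `y` into `x`; the vertex `y` becomes isolated. -/
def mergeInto {V : Type*} (G : SimpleGraph V) (x y : V) : SimpleGraph V where
  Adj a b := a ≠ b ∧ a ≠ y ∧ b ≠ y ∧ (G.Adj a b ∨ (a = x ∧ G.Adj y b) ∨ (b = x ∧ G.Adj y a))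
  symm := ⟨fun a b h => ⟨h.1.symm, h.2.2.1, h.2.1, by
    rcases h.2.2.2 with h | h | h
    · exact Or.inl h.symm
    · exact Or.inr (Or.inr h)
    · exact Or.inr (Or.inl h)⟩⟩
  loopless := ⟨fun a h => h.1 rfl⟩

/-- The vertex `v` has at most two neighbours. -/
def NbrsInPair {V : Type*} (G : SimpleGraph V) (v : V) : Prop :=
  ∃ u t, ∀ b, G.Adj v b → b = u ∨ b = t

theorem Adj.mergeInto {V : Type*} {G : SimpleGraph V} {x y a b : V} (h : G.Adj a b)
    (ha : a ≠ y) (hb : b ≠ y) : (G.mergeInto x y).Adj a b :=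
  ⟨h.ne, ha, hb, Or.inl h⟩

/-- A predicate passed along the edges inside D spreads to all of D. In this form connectedness
moves between a graph and its contraction without transporting walks. -/
theorem induce_connected_iff_forall {V : Type*} (G : SimpleGraph V) (D : Set V) :
    (G.induce D).Connected ↔ D.Nonempty ∧ ∀ P : V → Prop,
      (∀ a ∈ D, ∀ b ∈ D, G.Adj a b → P a → P b) → ∀ a ∈ D, ∀ b ∈ D, P a → P b := by
  constructor
  · intro h
    refine ⟨?_, fun P hP a ha b hb hPa => ?_⟩
    · obtain ⟨v⟩ := h.nonempty
      exact ⟨v.1, v.2⟩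
    · obtain ⟨w⟩ := h.preconnected ⟨a, ha⟩ ⟨b, hb⟩
      have key : ∀ (v v' : D), (G.induce D).Walk v v' → P v → P v' := by
        intro v v' w
        induction w with
        | nil => exact id
        | cons h _ ih => exact fun hv => ih (hP _ (Subtype.prop _) _ (Subtype.prop _) h hv)
      exact key _ _ w hPa
  · rintro ⟨⟨a, ha⟩, h⟩
    rw [connected_iff_exists_forall_reachable]
    refine ⟨⟨a, ha⟩, fun ⟨b, hb⟩ => ?_⟩
    obtain ⟨_, hr⟩ := h (fun v => ∃ h : v ∈ D, (G.induce D).Reachable ⟨a, ha⟩ ⟨v, h⟩)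
      (fun v _ v' hv' hadj ⟨h1, h2⟩ => ⟨hv', h2.trans (Adj.reachable (by simpa using hadj))⟩)
      a ha b hb ⟨ha, Reachable.refl _⟩
    exact hr

theorem isMinor_completeGraph_of_mergeInto {V : Type*} {G : SimpleGraph V} {x y : V}
    (hxy : G.Adj x y) (h : (completeGraph (Fin 4)).IsMinor (G.mergeInto x y)) :
    (completeGraph (Fin 4)).IsMinor G := by
  obtain ⟨D, hconn, hdisj, hadj⟩ := h
  -- The vertex y is isolated after the merge, so a branch set containing it would be {y}, with no
  -- edge to the other branch sets.
  have hy : ∀ i, y ∉ D i := by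
    intro i hyi
    obtain ⟨j, hj⟩ : ∃ j : Fin 4, i ≠ j := (exists_ne i).imp fun _ h => h.symm
    obtain ⟨a, ha, b, -, hab⟩ := hadj i j hj
    have := ((induce_connected_iff_forall _ _).1 (hconn i)).2 (fun v => v = y)
      (fun a _ b _ hab e => absurd e hab.2.1) y hyi a ha rfl
    exact hab.2.1 this
  -- Undo the contraction: y joins the branch set of x, if there is one.
  refine ⟨fun i => {v | v ∈ D i ∨ (v = y ∧ x ∈ D i)}, fun i => ?_, fun i j hij => ?_,
    fun i j hij => ?_⟩
  · rw [induce_connected_iff_forall]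
    obtain ⟨hne, hc⟩ := (induce_connected_iff_forall _ _).1 (hconn i)
    refine ⟨hne.mono fun v hv => Or.inl hv, fun P hP => ?_⟩
    have h1 : ∀ a ∈ D i, ∀ b ∈ D i, P a → P b := by
      refine hc P fun a ha b hb hab hPa => ?_
      rcases hab.2.2.2 with h | ⟨rfl, h⟩ | ⟨rfl, h⟩
      · exact hP a (Or.inl ha) b (Or.inl hb) h hPa
      · exact hP y (Or.inr ⟨rfl, ha⟩) b (Or.inl hb) h
          (hP a (Or.inl ha) y (Or.inr ⟨rfl, ha⟩) hxy hPa)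
      · exact hP y (Or.inr ⟨rfl, hb⟩) b (Or.inl hb) hxy.symm
          (hP a (Or.inl ha) y (Or.inr ⟨rfl, hb⟩) h.symm hPa)
    rintro a (ha | ⟨rfl, ha⟩) b (hb | ⟨rfl, hb⟩) hPa
    · exact h1 a ha b hb hPa
    · exact hP x (Or.inl hb) b (Or.inr ⟨rfl, hb⟩) hxy (h1 a ha x hb hPa)
    · exact h1 x ha b hb (hP a (Or.inr ⟨rfl, ha⟩) x (Or.inl ha) hxy.symm hPa)
    · exact hPa
  · have hd := Set.disjoint_left.1 (hdisj i j hij)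
    rw [Set.disjoint_left]
    rintro v (hv | ⟨rfl, hv⟩) (hv' | ⟨h, hv'⟩)
    · exact hd hv hv'
    · exact hy i (h ▸ hv)
    · exact hy j hv'
    · exact hd hv hv'
  · obtain ⟨a, ha, b, hb, hab⟩ := hadj i j hij
    rcases hab.2.2.2 with h | ⟨rfl, h⟩ | ⟨rfl, h⟩
    · exact ⟨a, Or.inl ha, b, Or.inl hb, h⟩
    · exact ⟨y, Or.inr ⟨rfl, ha⟩, b, Or.inl hb, h⟩
    · exact ⟨a, Or.inl ha, y, Or.inr ⟨rfl, hb⟩, h.symm⟩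

theorem isMinor_completeGraph_of_adj {V : Type*} {G : SimpleGraph V} {a b c d : V}
    (hab : G.Adj a b) (hac : G.Adj a c) (had : G.Adj a d) (hbc : G.Adj b c) (hbd : G.Adj b d)
    (hcd : G.Adj c d) : (completeGraph (Fin 4)).IsMinor G := by
  have hpair : ∀ i j : Fin 4, i ≠ j → G.Adj (![a, b, c, d] i) (![a, b, c, d] j) := by
    intro i j hij
    fin_cases i <;> fin_cases j <;> first | exact absurd rfl hij | skip
    all_goals first | assumption | (apply Adj.symm; assumption)
  refine ⟨fun i => {![a, b, c, d] i}, fun i => ?_, fun i j hij => ?_, fun i j hij => ?_⟩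
  · rw [induce_connected_iff_forall]
    refine ⟨Set.singleton_nonempty _, fun P _ v hv v' hv' h => ?_⟩
    rw [Set.mem_singleton_iff] at hv hv'
    rw [hv']; rwa [hv] at h
  · exact Set.disjoint_singleton.2 (hpair i j hij).ne
  · exact ⟨_, rfl, _, rfl, hpair i j hij⟩

/-! ### Vertices with at most two neighbours in K₄-minor-free graphs -/

/-- A vertex which has at most two neighbours after a merge, but not before, is a common neighbour
of the two merged vertices, and has only one further neighbour. -/
theorem NbrsInPair.of_mergeInto {V : Type*} {G : SimpleGraph V} {x y v : V} (hxy : x ≠ y) (hvx : v ≠ x)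
    (hvy : v ≠ y) (h : (G.mergeInto x y).NbrsInPair v) (hG : ¬ G.NbrsInPair v) :
    G.Adj v x ∧ G.Adj v y ∧ ∃ t, ∀ b, G.Adj v b → b = x ∨ b = y ∨ b = t := by
  obtain ⟨u, t, hut⟩ := h
  have h1 : ∀ b, G.Adj v b → b = u ∨ b = t ∨ b = y := by
    intro b hb
    by_cases hby : b = y
    · exact Or.inr (Or.inr hby)
    · rcases hut b (hb.mergeInto hvy hby) with h | h <;> simp [h]
  have hy : G.Adj v y := by
    by_contra hy
    refine hG ⟨u, t, fun b hb => ?_⟩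
    rcases h1 b hb with h | h | rfl
    exacts [Or.inl h, Or.inr h, absurd hb hy]
  have hx := hut x ⟨hvx, hvy, hxy, Or.inr (Or.inr ⟨rfl, hy.symm⟩)⟩
  obtain ⟨t', ht'⟩ : ∃ t', ∀ b, G.Adj v b → b = x ∨ b = y ∨ b = t' := by
    rcases hx with rfl | rfl
    · exact ⟨t, fun b hb => by rcases h1 b hb with h | h | h <;> simp [h]⟩
    · exact ⟨u, fun b hb => by rcases h1 b hb with h | h | h <;> simp [h]⟩
  refine ⟨?_, hy, t', ht'⟩
  by_contra hvx'
  refine hG ⟨y, t', fun b hb => ?_⟩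
  rcases ht' b hb with rfl | h | h
  exacts [absurd hb hvx', Or.inl h, Or.inr h]

/-- Contract edges while all vertices except r keep three neighbours. Where this fails, the graph
near r is forced to be nearly K₄. The exempt vertex r absorbs contractions, as its own degree is not
controlled. -/
theorem isMinor_completeGraph_of_forall_not_nbrsInPair {V : Type*} [DecidableEq V] (n : ℕ) :
    ∀ (G : SimpleGraph V) (A : Finset V) (r : V), A.card = n →
      (∀ a b, G.Adj a b → a ∈ A) → r ∈ A → (∃ v ∈ A, v ≠ r) →
      (∀ v ∈ A, v ≠ r → ¬ G.NbrsInPair v) → (completeGraph (Fin 4)).IsMinor G := by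
  induction n using Nat.strong_induction_on with
  | _ n ih =>
  intro G A r hcard hA hr hne hdeg
  -- the induction hypothesis for graphs obtained by merging
  have hmerge : ∀ (H : SimpleGraph V) (B : Finset V) (x y : V), B ⊆ A → H.Adj x y →
      (∀ a b, H.Adj a b → a ∈ B) → r ∈ B → r ≠ y → (∃ v ∈ B, v ≠ r ∧ v ≠ y) →
      (∀ v ∈ B, v ≠ r → v ≠ y → ¬ (H.mergeInto x y).NbrsInPair v) →
      (completeGraph (Fin 4)).IsMinor H := by
    intro H B x y hBA hxy hB hrB hry hex hlow
    apply isMinor_completeGraph_of_mergeInto hxy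
    refine ih (B.erase y).card ?_ _ (B.erase y) r rfl ?_ (Finset.mem_erase.2 ⟨hry, hrB⟩) ?_ ?_
    · have h1 := Finset.card_erase_lt_of_mem (hB y x hxy.symm)
      have h2 := Finset.card_le_card hBA
      omega
    · rintro a b ⟨-, hay, -, h⟩
      rw [Finset.mem_erase]
      refine ⟨hay, ?_⟩
      rcases h with h | ⟨rfl, -⟩ | ⟨-, h⟩
      exacts [hB _ _ h, hB _ _ hxy, hB _ _ h.symm]
    · obtain ⟨v, hv, hvr, hvy⟩ := hex
      exact ⟨v, Finset.mem_erase.2 ⟨hvy, hv⟩, hvr⟩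
    · intro v hv hvr
      rw [Finset.mem_erase] at hv
      exact hlow v hv.2 hvr hv.1
  by_cases hr0 : ∃ y, G.Adj r y
  swap
  -- An isolated r can be dropped; any other vertex then serves as the exempt one.
  · push Not at hr0
    obtain ⟨v, hv, hvr⟩ := hne
    refine ih (A.erase r).card ?_ G (A.erase r) v rfl ?_ (Finset.mem_erase.2 ⟨hvr, hv⟩) ?_ ?_
    · rw [← hcard]
      exact Finset.card_erase_lt_of_mem hr
    · intro a b hab
      refine Finset.mem_erase.2 ⟨?_, hA a b hab⟩
      rintro rfl
      exact hr0 b hab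
    · have h1 := hdeg v hv hvr
      simp only [NbrsInPair, not_exists, not_forall] at h1
      obtain ⟨b, hb, -⟩ := h1 v v
      refine ⟨b, Finset.mem_erase.2 ⟨?_, hA _ _ hb.symm⟩, hb.ne'⟩
      rintro rfl
      exact hr0 v hb.symm
    · intro w hw _
      rw [Finset.mem_erase] at hw
      exact hdeg w hw.2 hw.1
  obtain ⟨y₀, hy₀⟩ := hr0
  -- merging a neighbour of `r` into `r`
  have hroot : ∀ y, G.Adj r y → (completeGraph (Fin 4)).IsMinor G ∨
      ∃ v, G.Adj v r ∧ G.Adj v y ∧ ∃ t, ∀ b, G.Adj v b → b = r ∨ b = y ∨ b = t := by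
    intro y hy
    by_cases hlow : ∀ v ∈ A, v ≠ r → v ≠ y → ¬ (G.mergeInto r y).NbrsInPair v
    · left
      refine hmerge G A r y subset_rfl hy hA hr hy.ne ?_ hlow
      have h1 := hdeg y (hA _ _ hy.symm) hy.ne'
      simp only [NbrsInPair, not_exists, not_forall] at h1
      obtain ⟨b, hb, hbr⟩ := h1 r r
      exact ⟨b, hA _ _ hb.symm, fun h => hbr (Or.inl h), hb.ne'⟩
    · right
      push Not at hlow
      obtain ⟨v, hv, hvr, hvy, hvl⟩ := hlow
      exact ⟨v, hvl.of_mergeInto hy.ne hvr hvy (hdeg v hv hvr)⟩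
  -- Using `hroot` twice gives adjacent neighbours y and w of r, each with exactly three neighbours.
  rcases hroot y₀ hy₀ with h | ⟨y, hyr, hyy₀, t, ht⟩
  · exact h
  rcases hroot y hyr.symm with h | ⟨w, hwr, hwy, a, hwa⟩
  · exact h
  obtain ⟨b, hyb⟩ : ∃ b, ∀ v, G.Adj y v → v = r ∨ v = w ∨ v = b := by
    rcases ht w hwy.symm with h | rfl | rfl
    · exact absurd h hwr.ne
    · exact ⟨t, ht⟩
    · exact ⟨y₀, fun v hv => by rcases ht v hv with h | h | h <;> simp [h]⟩
  have hyA := hA _ _ hyr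
  have hwA := hA _ _ hwr
  have hdy := hdeg y hyA hyr.ne
  have hdw := hdeg w hwA hwr.ne
  simp only [NbrsInPair, not_exists, not_forall, not_or] at hdy hdw
  obtain ⟨b', hb', hbr, hbw⟩ := hdy r w
  obtain rfl : b' = b := by
    rcases hyb b' hb' with h | h | h
    exacts [absurd h hbr, absurd h hbw, h]
  obtain ⟨a', ha', har, hay⟩ := hdw r y
  obtain rfl : a' = a := by
    rcases hwa a' ha' with h | h | h
    exacts [absurd h har, absurd h hay, h]
  rename' a' => a, b' => b, hb' => hyb', ha' => hwa'
  by_cases hab : a = b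
  swap
  -- After contracting wy the merged vertex has the neighbours r, a, b. Any other vertex that loses
  -- a neighbour is adjacent to both w and y, and only r is.
  · refine hmerge G A w y subset_rfl hwy hA hr hyr.ne' ⟨w, hwA, hwr.ne, hwy.ne⟩ ?_
    intro v hv hvr hvy hlow
    by_cases hvw : v = w
    · subst hvw
      obtain ⟨u, s, hus⟩ := hlow
      have h1 := hus r (hwr.mergeInto hvy hyr.ne')
      have h2 := hus a (hwa'.mergeInto hvy hay)
      have h3 := hus b ⟨Ne.symm hbw, hvy, hyb'.ne', Or.inr (Or.inl ⟨rfl, hyb'⟩)⟩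
      grind
    · obtain ⟨h1, h2, -⟩ := hlow.of_mergeInto hwy.ne hvw hvy (hdeg v hv hvr)
      rcases hwa v h1.symm with h | h | rfl
      · exact hvr h
      · exact hvy h
      rcases hyb v h2.symm with h | h | h
      exacts [hvr h, hvw h, hab h]
  subst hab
  by_cases hadjr : G.Adj a r
  · exact isMinor_completeGraph_of_adj hwr.symm hyr.symm hadjr.symm hwy hwa' hyb'
  have haA := hA _ _ hwa'.symm
  have hwy' := hwy.ne
  have hrw := hwr.ne'
  have hry := hyr.ne'
  have hwa_ne := hwa'.ne
  have hya_ne := hyb'.ne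
  have hedge : ∀ u v, u ≠ w → u ≠ y → v ≠ w → v ≠ y → G.Adj u v →
      ((G.mergeInto r w).mergeInto r y).Adj u v :=
    fun u v h1 h2 h3 h4 h => (h.mergeInto h1 h3).mergeInto h2 h4
  have hry₁ : (G.mergeInto r w).Adj r y := hyr.symm.mergeInto hrw hwy'.symm
  have har₁ : (G.mergeInto r w).Adj a r :=
    ⟨har, hwa_ne.symm, hrw, Or.inr (Or.inr ⟨rfl, hwa'⟩)⟩
  have har₂ : ((G.mergeInto r w).mergeInto r y).Adj a r := har₁.mergeInto hya_ne.symm hry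
  have hA₁ : ∀ u v, (G.mergeInto r w).Adj u v → u ∈ A.erase w := by
    rintro u v ⟨-, hu, -, h⟩
    refine Finset.mem_erase.2 ⟨hu, ?_⟩
    rcases h with h | ⟨rfl, -⟩ | ⟨-, h⟩
    exacts [hA _ _ h, hr, hA _ _ h.symm]
  have hA₂ : ∀ u v, ((G.mergeInto r w).mergeInto r y).Adj u v → u ∈ (A.erase w).erase y := by
    rintro u v ⟨-, hu, -, h⟩
    refine Finset.mem_erase.2 ⟨hu, ?_⟩
    rcases h with h | ⟨rfl, -⟩ | ⟨-, h⟩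
    exacts [hA₁ _ _ h, Finset.mem_erase.2 ⟨hrw, hr⟩, hA₁ _ _ h.symm]
  have hother : ∀ v ∈ A, v ≠ r → v ≠ w → v ≠ y → v ≠ a → ∀ b, G.Adj v b →
      ((G.mergeInto r w).mergeInto r y).Adj v b := by
    intro v _ hvr hvw hvy hva b hvb
    refine hedge v b hvw hvy ?_ ?_ hvb
    · rintro rfl
      rcases hwa v hvb.symm with h | h | h <;> contradiction
    · rintro rfl
      rcases hyb v hvb.symm with h | h | h <;> contradiction
  -- With w and y contracted into r, a is the only vertex besides r whose neighbourhood has shrunk.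
  by_cases hlow : ((G.mergeInto r w).mergeInto r y).NbrsInPair a
  swap
  · apply isMinor_completeGraph_of_mergeInto hwr.symm
    refine hmerge _ (A.erase w) r y (Finset.erase_subset _ _) hry₁ hA₁
      (Finset.mem_erase.2 ⟨hrw, hr⟩) hry
      ⟨a, Finset.mem_erase.2 ⟨hwa_ne.symm, haA⟩, har, hya_ne.symm⟩ ?_
    intro v hv hvr hvy
    rw [Finset.mem_erase] at hv
    by_cases hva : v = a
    · rwa [hva]
    · rintro ⟨u, s, hus⟩
      exact hdeg v hv.2 hvr
        ⟨u, s, fun b hb => hus b (hother v hv.2 hvr hv.1 hvy hva b hb)⟩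
  obtain ⟨p, hp⟩ : ∃ p, ∀ v, G.Adj a v → v = w ∨ v = y ∨ v = p := by
    obtain ⟨u, s, hus⟩ := hlow
    have h0 := hus r har₂
    have h1 : ∀ v, G.Adj a v → v = w ∨ v = y ∨ v = u ∨ v = s := by
      intro v hv
      by_cases hvw : v = w
      · exact Or.inl hvw
      by_cases hvy : v = y
      · exact Or.inr (Or.inl hvy)
      exact Or.inr (Or.inr (hus v (hedge a v hwa_ne.symm hya_ne.symm hvw hvy hv)))
    rcases h0 with h0 | h0
    · refine ⟨s, fun v hv => ?_⟩
      have hvr : v ≠ r := by rintro rfl; exact hadjr hv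
      have := h1 v hv
      grind
    · refine ⟨u, fun v hv => ?_⟩
      have hvr : v ≠ r := by rintro rfl; exact hadjr hv
      have := h1 v hv
      grind
  have hda := hdeg a haA har
  simp only [NbrsInPair, not_exists, not_forall, not_or] at hda
  obtain ⟨p', hap, hpw, hpy⟩ := hda w y
  obtain rfl : p' = p := by
    rcases hp p' hap with h | h | h
    exacts [absurd h hpw, absurd h hpy, h]
  rename' p' => p
  have hpr : p ≠ r := by rintro rfl; exact hadjr hap
  have hpA := hA _ _ hap.symm
  have hpa := hap.ne'
  -- The path r, p, a replaces the edge ra missing from a K₄ on r, w, y, a.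
  by_cases hadjp : G.Adj r p
  · apply isMinor_completeGraph_of_mergeInto hadjp
    exact isMinor_completeGraph_of_adj (a := r) (b := w) (c := y) (d := a)
      (hwr.symm.mergeInto hpr.symm (Ne.symm hpw)) (hyr.symm.mergeInto hpr.symm (Ne.symm hpy))
      ⟨Ne.symm har, hpr.symm, hap.ne, Or.inr (Or.inl ⟨rfl, hap.symm⟩)⟩
      (hwy.mergeInto (Ne.symm hpw) (Ne.symm hpy)) (hwa'.mergeInto (Ne.symm hpw) hap.ne)
      (hyb'.mergeInto (Ne.symm hpy) hap.ne)
  -- Contract a into r as well. A vertex left with too few neighbours would be adjacent to a, hence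
  -- equal to p, and also adjacent to one of r, w, y, which p is not.
  apply isMinor_completeGraph_of_mergeInto hwr.symm
  apply isMinor_completeGraph_of_mergeInto hry₁
  refine hmerge _ ((A.erase w).erase y) r a
    ((Finset.erase_subset _ _).trans (Finset.erase_subset _ _)) har₂.symm hA₂
    (Finset.mem_erase.2 ⟨hry, Finset.mem_erase.2 ⟨hrw, hr⟩⟩) (Ne.symm har)
    ⟨p, Finset.mem_erase.2 ⟨hpy, Finset.mem_erase.2 ⟨hpw, hpA⟩⟩, hpr, hpa⟩ ?_
  intro v hv hvr hva hvl
  rw [Finset.mem_erase, Finset.mem_erase] at hv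
  obtain ⟨hvy, hvw, hvA⟩ := hv
  obtain ⟨-, hva', -⟩ := hvl.of_mergeInto (Ne.symm har) hvr hva (by
    rintro ⟨u, s, hus⟩
    exact hdeg v hvA hvr ⟨u, s, fun b hb => hus b (hother v hvA hvr hvw hvy hva b hb)⟩)
  have hav : G.Adj a v := by
    rcases hva'.2.2.2 with ⟨-, -, -, h | ⟨h, -⟩ | ⟨h, -⟩⟩ | ⟨h, -⟩ | ⟨h, -⟩
    exacts [h.symm, absurd h hvr, absurd h har, absurd h hvr, absurd h har]
  obtain rfl : v = p := by
    rcases hp v hav with h | h | h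
    exacts [absurd h hvw, absurd h hvy, h]
  obtain ⟨hvr₂, -⟩ := hvl.of_mergeInto (Ne.symm har) hvr hva (by
    rintro ⟨u, s, hus⟩
    exact hdeg v hvA hvr ⟨u, s, fun b hb => hus b (hother v hvA hvr hvw hvy hva b hb)⟩)
  rcases hvr₂.2.2.2 with ⟨-, -, -, h | ⟨h, -⟩ | ⟨-, h⟩⟩ | ⟨h, -⟩ | ⟨-, -, -, -, h⟩
  · exact hadjp h.symm
  · exact hvr h
  · rcases hwa v h with h | h | h <;> contradiction
  · exact hvr h
  · rcases h with h | ⟨h, -⟩ | ⟨h, -⟩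
    · rcases hyb v h with h | h | h <;> contradiction
    · exact hry h.symm
    · exact hvr h

/-! ### Weighted toughness and token distributions -/

/-- A weighted toughness condition for the graph `B` on the vertex set `A`, where `m a b` counts
additional paths of length two between `a` and `b`. The components of `B - S` are counted by means
of functions `φ` that are constant on each of them. -/
def TokenTough {V : Type*} [DecidableEq V] (B : SimpleGraph V) (A : Finset V) (m : V → V → ℕ)
    (g : V → ℕ) : Prop :=
  ∀ S ⊆ A, ∀ φ : V → ℕ, (∀ a ∈ A \ S, ∀ b ∈ A \ S, B.Adj a b → φ a = φ b) →
    ∑ a ∈ S, ∑ b ∈ S, m a b + 2 * ((A \ S).image φ).card ≤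
      2 * ∑ a ∈ S, g a + if S = ∅ then 2 else 0

/-- The parent function `p` and the rank function `d` describe a spanning arborescence of `B` on
the vertex set `A` with root `r`, and the tail of each arc has a token for it. -/
def IsTokenArborescence {V : Type*} (B : SimpleGraph V) (A : Finset V) (r : V)
    (p : V → V) (d : V → ℕ) (o : V → V → ℕ) : Prop :=
  ∀ v ∈ A, v ≠ r → p v ∈ A ∧ B.Adj (p v) v ∧ d (p v) < d v ∧ 1 ≤ o (p v) v

/-- The function `o` distributes the `m a b` tokens of each pair `a`, `b` to `a` and `b` such that
each vertex `a` receives at most `g a` tokens. -/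
def IsTokenDistribution {V : Type*} (A : Finset V) (m : V → V → ℕ) (g : V → ℕ)
    (o : V → V → ℕ) : Prop :=
  (∀ a ∈ A, ∀ b ∈ A, m a b ≤ o a b + o b a) ∧ ∀ a ∈ A, ∑ b ∈ A, o a b ≤ g a

/-- The labelling φ of the graph without s extends to s by the label c, so toughness applies with s
kept. -/
theorem TokenTough.card_insert_le {V : Type*} [DecidableEq V] {B : SimpleGraph V} {A : Finset V}
    {m : V → V → ℕ} {g : V → ℕ} (h : B.TokenTough A m g) {s : V} (hs : s ∈ A) {S : Finset V}
    (hS : S ⊆ A.erase s) {φ : V → ℕ}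
    (hφ : ∀ a ∈ A.erase s \ S, ∀ b ∈ A.erase s \ S, B.Adj a b → φ a = φ b) (c : ℕ)
    (hc : ∀ b ∈ A.erase s \ S, B.Adj s b → φ b = c) :
    ∑ a ∈ S, ∑ b ∈ S, m a b + 2 * (insert c ((A.erase s \ S).image φ)).card ≤
      2 * ∑ a ∈ S, g a + if S = ∅ then 2 else 0 := by
  have hsS : s ∉ S := fun h => (Finset.mem_erase.1 (hS h)).1 rfl
  have hmem : ∀ a, a ∈ A \ S → a ≠ s → a ∈ A.erase s \ S := by
    intro a ha has
    simp only [Finset.mem_sdiff, Finset.mem_erase] at ha ⊢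
    exact ⟨⟨has, ha.1⟩, ha.2⟩
  refine le_trans ?_ (h S (hS.trans (Finset.erase_subset _ _)) (Function.update φ s c) ?_)
  · gcongr
    intro x hx
    rw [Finset.mem_insert, Finset.mem_image] at hx
    rw [Finset.mem_image]
    rcases hx with rfl | ⟨a, ha, rfl⟩
    · exact ⟨s, Finset.mem_sdiff.2 ⟨hs, hsS⟩, by simp⟩
    · simp only [Finset.mem_sdiff, Finset.mem_erase] at ha
      exact ⟨a, Finset.mem_sdiff.2 ⟨ha.1.2, ha.2⟩, Function.update_of_ne ha.1.1 _ _⟩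
  · intro a ha b hb hab
    by_cases has : a = s
    · subst has
      rw [Function.update_self, Function.update_of_ne hab.ne', hc b (hmem b hb hab.ne') hab]
    · by_cases hbs : b = s
      · subst hbs
        rw [Function.update_self, Function.update_of_ne has, hc a (hmem a ha has) hab.symm]
      · rw [Function.update_of_ne has, Function.update_of_ne hbs]
        exact hφ a (hmem a ha has) b (hmem b hb hbs) hab

theorem TokenTough.card_le {V : Type*} [DecidableEq V] {B : SimpleGraph V} {A : Finset V}
    {m : V → V → ℕ} {g : V → ℕ} (h : B.TokenTough A m g) {s : V} (hs : s ∈ A) {S : Finset V}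
    (hS : S ⊆ A.erase s) {φ : V → ℕ}
    (hφ : ∀ a ∈ A.erase s \ S, ∀ b ∈ A.erase s \ S, B.Adj a b → φ a = φ b) (c : ℕ)
    (hc : ∀ b ∈ A.erase s \ S, B.Adj s b → φ b = c) :
    ∑ a ∈ S, ∑ b ∈ S, m a b + 2 * ((A.erase s \ S).image φ).card ≤
      2 * ∑ a ∈ S, g a + if S = ∅ then 2 else 0 := by
  refine le_trans ?_ (h.card_insert_le hs hS hφ c hc)
  gcongr
  exact Finset.subset_insert _ _

theorem TokenTough.card_succ_le {V : Type*} [DecidableEq V] {B : SimpleGraph V} {A : Finset V}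
    {m : V → V → ℕ} {g : V → ℕ} (h : B.TokenTough A m g) {s : V} (hs : s ∈ A) {S : Finset V}
    (hS : S ⊆ A.erase s) {φ : V → ℕ}
    (hφ : ∀ a ∈ A.erase s \ S, ∀ b ∈ A.erase s \ S, B.Adj a b → φ a = φ b)
    (hc : ∀ b ∈ A.erase s \ S, ¬ B.Adj s b) :
    ∑ a ∈ S, ∑ b ∈ S, m a b + 2 * (((A.erase s \ S).image φ).card + 1) ≤
      2 * ∑ a ∈ S, g a + if S = ∅ then 2 else 0 := by
  -- All neighbours of s are deleted, so s is a component of its own and may take a fresh label.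
  obtain ⟨c, hc'⟩ := Infinite.exists_notMem_finset ((A.erase s \ S).image φ)
  have := h.card_insert_le hs hS hφ c (fun b hb hab => absurd hab (hc b hb))
  rwa [Finset.card_insert_of_notMem hc'] at this

theorem TokenTough.card_delete_le {V : Type*} [DecidableEq V] {B : SimpleGraph V} {A : Finset V}
    {m : V → V → ℕ} {g : V → ℕ} (h : B.TokenTough A m g) (hm : ∀ a b, m a b = m b a)
    {s : V} (hs : s ∈ A) (hms : m s s = 0) {S : Finset V}
    (hS : S ⊆ A.erase s) {φ : V → ℕ}
    (hφ : ∀ a ∈ A.erase s \ S, ∀ b ∈ A.erase s \ S, B.Adj a b → φ a = φ b) :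
    ∑ a ∈ S, ∑ b ∈ S, m a b + 2 * ∑ a ∈ S, m a s + 2 * ((A.erase s \ S).image φ).card ≤
      2 * ∑ a ∈ S, g a + 2 * g s := by
  have hsS : s ∉ S := fun h => (Finset.mem_erase.1 (hS h)).1 rfl
  have heq : A \ insert s S = A.erase s \ S := by
    ext a; simp only [Finset.mem_sdiff, Finset.mem_insert, Finset.mem_erase]; tauto
  have := h (insert s S) (Finset.insert_subset hs (hS.trans (Finset.erase_subset _ _))) φ
    (by rwa [heq])
  rw [heq, if_neg (Finset.insert_ne_empty _ _)] at this
  simp only [Finset.sum_insert hsS, Finset.sum_add_distrib, hms] at this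
  rw [Finset.sum_congr rfl fun a _ => hm s a] at this
  omega

/-! ### Lifting a solution back over a removed vertex -/

/-- The arithmetic of replacing the two series bundles of sizes `m` and `n` at a vertex of
capacity `c` by one bundle, in case no arc is needed along the new bundle. -/
theorem exists_token_split {m n M c x y : ℕ} (hc : 1 ≤ c)
    (h : M + (max 1 (m + n - c) - (m - c) - (n - c)) ≤ x + y) :
    ∃ ut tu us su ts st : ℕ, (ut + us ≤ (m - c) + x ∧ tu + ts ≤ (n - c) + y ∧ su + st ≤ c ∧
      m ≤ us + su ∧ n ≤ ts + st ∧ M ≤ ut + tu) ∧ (1 ≤ us ∨ 1 ≤ ts) := by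
  -- The shared demand α is paid by u as far as its x tokens allow, and by t beyond that.
  obtain ⟨α, hα⟩ : ∃ α, α = max 1 (m + n - c) - (m - c) - (n - c) := ⟨_, rfl⟩
  rw [← hα] at h
  refine ⟨x - min x α, y - (α - min x α), (m - c) + min x α, m - ((m - c) + min x α),
    (n - c) + (α - min x α), n - ((n - c) + (α - min x α)), ?_⟩
  omega

/-- The arithmetic of replacing the two series bundles of sizes `m` and `n` at a vertex of
capacity `c` by one bundle, in case an arc is needed along the new bundle. -/
theorem exists_token_split_arc {m n M c x y : ℕ} (hc : 1 ≤ c) (hx : 1 ≤ x)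
    (h : M + (max 1 (m + n - c) - (m - c) - (n - c)) ≤ x + y) :
    ∃ ut tu us su ts st : ℕ, (ut + us ≤ (m - c) + x ∧ tu + ts ≤ (n - c) + y ∧ su + st ≤ c ∧
      m ≤ us + su ∧ n ≤ ts + st ∧ M ≤ ut + tu) ∧
      ((1 ≤ us ∧ 1 ≤ st) ∨ (1 ≤ M ∧ 1 ≤ ut ∧ (1 ≤ us ∨ 1 ≤ ts))) := by
  obtain ⟨α, hα⟩ : ∃ α, α = max 1 (m + n - c) - (m - c) - (n - c) := ⟨_, rfl⟩
  rw [← hα] at h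
  by_cases h0 : 1 ≤ α
  -- Since x ≥ 1, u pays part of α and so reaches s; the maximum reserves a token of s for the arc
  -- to t.
  · refine ⟨x - min x α, y - (α - min x α), (m - c) + min x α, m - ((m - c) + min x α),
      (n - c) + (α - min x α), max 1 (n - ((n - c) + (α - min x α))), ?_⟩
    omega
  -- Now α = 0, so one bundle is empty and the other exceeds c. If M ≥ 1 the old arc stays and the
  -- excess reaches s. If M = 0, all x tokens of u go to s, and the arc runs through s.
  by_cases hM : 1 ≤ M
  · refine ⟨x, y, (m - c), m - (m - c), (n - c), n - (n - c), ?_⟩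
    omega
  · refine ⟨0, 0, (m - c) + x, m - ((m - c) + x), (n - c), max 1 (n - (n - c)), ?_⟩
    omega

theorem sum_add_le_of_eq_of_ne {V : Type*} [DecidableEq V] {A : Finset V} {t : V} (ht : t ∈ A)
    {f f' : V → ℕ} {k : ℕ} (hk : k + f t ≤ f' t) (h : ∀ b ∈ A, b ≠ t → f b = f' b) :
    k + ∑ b ∈ A, f b ≤ ∑ b ∈ A, f' b := by
  rw [← Finset.add_sum_erase A f ht, ← Finset.add_sum_erase A f' ht]
  have : ∑ b ∈ A.erase t, f b = ∑ b ∈ A.erase t, f' b :=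
    Finset.sum_congr rfl fun b hb => h b (Finset.mem_of_mem_erase hb) (Finset.ne_of_mem_erase hb)
  omega

/-- Adding a vertex of degree one to an arborescence with a token distribution. -/
theorem exists_arborescence_of_leaf {V : Type*} [DecidableEq V] {B B' : SimpleGraph V}
    {A : Finset V} {m : V → V → ℕ} {g g' : V → ℕ} {r s u : V} (hm : ∀ a b, m a b = m b a)
    (hms : ∀ a, a ≠ u → m a s = 0) (hs : s ∈ A) (hu : u ∈ A) (hus : B.Adj u s) (hsr : s ≠ r)
    (hB' : ∀ a b, B'.Adj a b → a ≠ s → b ≠ s → B.Adj a b)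
    (hg : ∀ a ∈ A, a ≠ s → a ≠ u → g' a ≤ g a) (hgu : max 1 (m u s - g s) + g' u ≤ g u)
    {p : V → V} {d : V → ℕ} {o : V → V → ℕ} (harb : B'.IsTokenArborescence (A.erase s) r p d o)
    (hdist : IsTokenDistribution (A.erase s) m g' o) :
    ∃ p d o, B.IsTokenArborescence A r p d o ∧ IsTokenDistribution A m g o := by
  have hsu := hus.ne'
  refine ⟨Function.update p s u, Function.update d s (d u + 1),
    fun a b => if a = s then (if b = u then min (m u s) (g s) else 0) else
      if b = s then (if a = u then max 1 (m u s - g s) else 0) else o a b, ?_, ?_, ?_⟩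
  · intro v hv hvr
    by_cases hvs : v = s
    · subst hvs
      simp [hu, hus, hsu.symm]
    · obtain ⟨h1, h2, h3, h4⟩ := harb v (Finset.mem_erase.2 ⟨hvs, hv⟩) hvr
      rw [Finset.mem_erase] at h1
      simp [hvs, h1.1, h1.2, h3, h4, hB' _ _ h2 h1.1 hvs]
  · intro a ha b hb
    by_cases has : a = s
    · subst has
      by_cases hbu : b = u
      · subst hbu
        simp only [if_true, hsu.symm, if_false]
        rw [hm]; omega
      · rw [hm, hms b hbu]; exact Nat.zero_le _
    · by_cases hbs : b = s
      · subst hbs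
        by_cases hau : a = u
        · subst hau
          simp only [if_true, hsu.symm, if_false]
          omega
        · rw [hms a hau]; exact Nat.zero_le _
      · simpa [has, hbs] using hdist.1 a (Finset.mem_erase.2 ⟨has, ha⟩) b
          (Finset.mem_erase.2 ⟨hbs, hb⟩)
  · intro a ha
    by_cases has : a = s
    · subst has
      simp [hu]
    · rw [← Finset.add_sum_erase A _ hs]
      have h1 : ∑ b ∈ A.erase s, (if a = s then (if b = u then min (m u s) (g s) else 0) else
          if b = s then (if a = u then max 1 (m u s - g s) else 0) else o a b) =
          ∑ b ∈ A.erase s, o a b :=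
        Finset.sum_congr rfl fun b hb => by simp [has, Finset.ne_of_mem_erase hb]
      have h2 := hdist.2 a (Finset.mem_erase.2 ⟨has, ha⟩)
      rw [h1]
      simp only [has, if_false, if_true]
      split_ifs with h
      · subst h; omega
      · have := hg a ha has h; omega

/-- Changing a token distribution when two series bundles at `s` have been replaced by one. -/
theorem exists_tokenDistribution_of_split {V : Type*} [DecidableEq V] {A : Finset V}
    {m : V → V → ℕ} {g g' : V → ℕ} {s u t : V} (hm : ∀ a b, m a b = m b a)
    (hms : ∀ a, a ≠ u → a ≠ t → m a s = 0) (hs : s ∈ A) (hu : u ∈ A) (ht : t ∈ A)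
    (hus : u ≠ s) (hts : t ≠ s) (hut : u ≠ t) (hg : ∀ a ∈ A, a ≠ s → a ≠ u → a ≠ t → g' a ≤ g a)
    (hgu : m u s - g s + g' u ≤ g u) (hgt : m t s - g s + g' t ≤ g t) {o : V → V → ℕ}
    (hdist : IsTokenDistribution (A.erase s) m g' o) {aut atu aus asu ats ast : ℕ}
    (h : aut + aus ≤ (m u s - g s) + o u t ∧ atu + ats ≤ (m t s - g s) + o t u ∧
      asu + ast ≤ g s ∧ m u s ≤ aus + asu ∧ m t s ≤ ats + ast ∧ m u t ≤ aut + atu) :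
    ∃ o' : V → V → ℕ, IsTokenDistribution A m g o' ∧ o' u t = aut ∧ o' t u = atu ∧ o' u s = aus ∧
      o' s u = asu ∧ o' t s = ats ∧ o' s t = ast ∧
      ∀ a b, a ≠ s → b ≠ s → ¬ (a = u ∧ b = t) → ¬ (a = t ∧ b = u) → o' a b = o a b := by
  obtain ⟨o', ho'⟩ : ∃ o' : V → V → ℕ, o' = fun a b =>
      if a = s then (if b = u then asu else if b = t then ast else 0) else
      if b = s then (if a = u then aus else if a = t then ats else 0) else
      if a = u ∧ b = t then aut else if a = t ∧ b = u then atu else o a b := ⟨_, rfl⟩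
  have e1 : o' u t = aut := by simp [ho', hus, hts]
  have e2 : o' t u = atu := by simp [ho', hus, hts, hut, hut.symm]
  have e3 : o' u s = aus := by simp [ho', hus]
  have e4 : o' s u = asu := by simp [ho']
  have e5 : o' t s = ats := by simp [ho', hts, hut.symm]
  have e6 : o' s t = ast := by simp [ho', hut.symm]
  have e7 : ∀ a b, a ≠ s → b ≠ s → ¬ (a = u ∧ b = t) → ¬ (a = t ∧ b = u) → o' a b = o a b := by
    intro a b h1 h2 h3 h4
    simp only [ho', h1, h2, h3, h4, if_false]
  have e8 : ∀ a, a ≠ u → a ≠ t → o' s a = 0 := by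
    intro a h1 h2; simp [ho', h1, h2]
  have e9 : ∀ a, a ≠ u → a ≠ t → a ≠ s → o' a s = 0 := by
    intro a h1 h2 h3; simp [ho', h1, h2, h3]
  clear ho'
  obtain ⟨h1, h2, h3, h4, h5, h6⟩ := h
  refine ⟨o', ⟨?_, ?_⟩, e1, e2, e3, e4, e5, e6, e7⟩
  · have hs' : ∀ a, m a s ≤ o' a s + o' s a := by
      intro a
      by_cases hau : a = u
      · subst hau; omega
      · by_cases hat : a = t
        · subst hat; omega
        · rw [hms a hau hat]; exact Nat.zero_le _
    intro a ha b hb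
    by_cases has : a = s
    · subst has
      rw [hm, add_comm]; exact hs' b
    by_cases hbs : b = s
    · subst hbs; exact hs' a
    by_cases hab : a = u ∧ b = t
    · obtain ⟨rfl, rfl⟩ := hab; omega
    by_cases hba : a = t ∧ b = u
    · obtain ⟨rfl, rfl⟩ := hba; rw [hm]; omega
    rw [e7 a b has hbs hab hba, e7 b a hbs has (by tauto) (by tauto)]
    exact hdist.1 a (Finset.mem_erase.2 ⟨has, ha⟩) b (Finset.mem_erase.2 ⟨hbs, hb⟩)
  · intro a ha
    by_cases has : a = s
    · subst has
      have : ∑ b ∈ A, o' a b = ∑ b ∈ {u, t}, o' a b := by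
        symm
        apply Finset.sum_subset
        · intro x hx
          rw [Finset.mem_insert, Finset.mem_singleton] at hx
          rcases hx with rfl | rfl <;> assumption
        · intro x _ hx
          rw [Finset.mem_insert, Finset.mem_singleton, not_or] at hx
          exact e8 x hx.1 hx.2
      rw [this, Finset.sum_pair hut]
      omega
    have hd := hdist.2 a (Finset.mem_erase.2 ⟨has, ha⟩)
    rw [← Finset.add_sum_erase A _ hs]
    by_cases hau : a = u
    · subst hau
      rw [e3]
      have := sum_add_le_of_eq_of_ne (A := A.erase s) (t := t) (Finset.mem_erase.2 ⟨hts, ht⟩)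
        (f := o' a) (f' := fun b => o a b + if b = t then m a s - g s else 0) (k := aus)
        (by simp only [if_true]; omega) (fun b hb hbt => by
          simp only [hbt, if_false]
          exact e7 a b has (Finset.ne_of_mem_erase hb) (by tauto) (by tauto))
      rw [Finset.sum_add_distrib, Finset.sum_ite_eq', if_pos (Finset.mem_erase.2 ⟨hts, ht⟩)] at this
      omega
    by_cases hat : a = t
    · subst hat
      rw [e5]
      have := sum_add_le_of_eq_of_ne (A := A.erase s) (t := u) (Finset.mem_erase.2 ⟨hus, hu⟩)
        (f := o' a) (f' := fun b => o a b + if b = u then m a s - g s else 0) (k := ats)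
        (by simp only [if_true]; omega) (fun b hb hbt => by
          simp only [hbt, if_false]
          exact e7 a b has (Finset.ne_of_mem_erase hb) (by tauto) (by tauto))
      rw [Finset.sum_add_distrib, Finset.sum_ite_eq', if_pos (Finset.mem_erase.2 ⟨hus, hu⟩)] at this
      omega
    · have h1 : ∑ b ∈ A.erase s, o' a b = ∑ b ∈ A.erase s, o a b :=
        Finset.sum_congr rfl fun b hb =>
          e7 a b has (Finset.ne_of_mem_erase hb) (by tauto) (by tauto)
      rw [e9 a hau hat has, h1]
      have := hg a ha has hau hat
      omega

/-- Attaching a vertex as a leaf to an arborescence. -/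
theorem IsTokenArborescence.insert_leaf {V : Type*} [DecidableEq V] {B B' : SimpleGraph V}
    {A : Finset V} {r s u : V} {p : V → V} {d : V → ℕ} {o o' : V → V → ℕ}
    (h : B'.IsTokenArborescence (A.erase s) r p d o) (hu : u ∈ A) (hus : B.Adj u s)
    (ho : 1 ≤ o' u s)
    (harc : ∀ v ∈ A, v ≠ s → v ≠ r → p v ≠ s → B'.Adj (p v) v → 1 ≤ o (p v) v →
      B.Adj (p v) v ∧ 1 ≤ o' (p v) v) :
    B.IsTokenArborescence A r (Function.update p s u) (Function.update d s (d u + 1)) o' := by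
  intro v hv hvr
  by_cases hvs : v = s
  · subst hvs
    simp [hu, hus, ho, hus.ne]
  · obtain ⟨h1, h2, h3, h4⟩ := h v (Finset.mem_erase.2 ⟨hvs, hv⟩) hvr
    rw [Finset.mem_erase] at h1
    obtain ⟨h5, h6⟩ := harc v hv hvs hvr h1.1 h2 h4
    simp [hvs, h1.1, h1.2, h3, h5, h6]

/-- Subdividing an arc of an arborescence. -/
theorem IsTokenArborescence.subdivide {V : Type*} [DecidableEq V] {B B' : SimpleGraph V}
    {A : Finset V} {r s u t : V} {p : V → V} {d : V → ℕ} {o o' : V → V → ℕ}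
    (h : B'.IsTokenArborescence (A.erase s) r p d o) (hs : s ∈ A) (hus : B.Adj u s)
    (hst : B.Adj s t) (ht : t ∈ A) (htr : t ≠ r) (hpt : p t = u)
    (hou : 1 ≤ o' u s) (hot : 1 ≤ o' s t)
    (harc : ∀ v ∈ A, v ≠ s → v ≠ r → v ≠ t → p v ≠ s → B'.Adj (p v) v → d (p v) < d v →
      1 ≤ o (p v) v → B.Adj (p v) v ∧ 1 ≤ o' (p v) v) :
    B.IsTokenArborescence A r (Function.update (Function.update p s u) t s)
      (Function.update (fun v => 2 * d v) s (2 * d u + 1)) o' := by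
  have hts := hst.ne'
  obtain ⟨h1, -, h3, -⟩ := h t (Finset.mem_erase.2 ⟨hts, ht⟩) htr
  rw [hpt] at h1 h3
  -- Doubling the ranks makes room for s strictly between u and t.
  intro v hv hvr
  by_cases hvs : v = s
  · subst hvs
    simp [hst.ne, Finset.mem_of_mem_erase h1, hus, hus.ne, hou]
  by_cases hvt : v = t
  · subst hvt
    refine ⟨by simpa using hs, by simpa using hst, ?_, by simpa using hot⟩
    simp [hvs]; omega
  · obtain ⟨h1, h2, h3, h4⟩ := h v (Finset.mem_erase.2 ⟨hvs, hv⟩) hvr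
    rw [Finset.mem_erase] at h1
    obtain ⟨h5, h6⟩ := harc v hv hvs hvr hvt h1.1 h2 h3 h4
    simp [hvs, hvt, h1.1, h1.2, h3, h5, h6]

/-- Adding a vertex of degree two to an arborescence that has an arc between its neighbours. -/
theorem exists_arborescence_of_degree_two_of_arc {V : Type*} [DecidableEq V]
    {B B' : SimpleGraph V} {A : Finset V} {m : V → V → ℕ} {g g' : V → ℕ} {r s u t : V}
    (hm : ∀ a b, m a b = m b a) (hmB : ∀ a b, 1 ≤ m a b → B.Adj a b)
    (hms : ∀ a, a ≠ u → a ≠ t → m a s = 0)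
    (hs : s ∈ A) (hu : u ∈ A) (ht : t ∈ A) (hus : B.Adj u s) (hst : B.Adj s t) (hut : u ≠ t)
    (hB' : ∀ a b, B'.Adj a b → a ≠ s → b ≠ s → ¬ (a = u ∧ b = t) → ¬ (a = t ∧ b = u) → B.Adj a b)
    (hg : ∀ a ∈ A, a ≠ s → a ≠ u → a ≠ t → g' a ≤ g a)
    (hgu : m u s - g s + g' u ≤ g u) (hgt : m t s - g s + g' t ≤ g t) (hgs : 1 ≤ g s)
    {p : V → V} {d : V → ℕ} {o : V → V → ℕ} (harb : B'.IsTokenArborescence (A.erase s) r p d o)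
    (hdist : IsTokenDistribution (A.erase s) m g' o)
    (hxy : m u t + (max 1 (m u s + m t s - g s) - (m u s - g s) - (m t s - g s)) ≤
      o u t + o t u) (htr : t ≠ r) (hpt : p t = u) :
    ∃ p d o, B.IsTokenArborescence A r p d o ∧ IsTokenDistribution A m g o := by
  obtain ⟨-, -, hd, hx⟩ := harb t (Finset.mem_erase.2 ⟨hst.ne', ht⟩) htr
  rw [hpt] at hx hd
  obtain ⟨aut, atu, aus, asu, ats, ast, hnum, hcase⟩ := exists_token_split_arc hgs hx hxy
  obtain ⟨o', hdist', e1, e2, e3, e4, e5, e6, e7⟩ := exists_tokenDistribution_of_split hm hms hs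
    hu ht hus.ne hst.ne' hut hg hgu hgt hdist hnum
  rcases hcase with ⟨h1, h2⟩ | ⟨h1, h2, h3⟩
  · refine ⟨_, _, o', harb.subdivide hs hus hst ht htr hpt (e3 ▸ h1) (e6 ▸ h2) ?_, hdist'⟩
    intro v hv hvs hvr hvt hps hadj hdv ho
    have n1 : ¬ (p v = u ∧ v = t) := fun h => hvt h.2
    have n2 : ¬ (p v = t ∧ v = u) := by
      rintro ⟨h, rfl⟩
      rw [h] at hdv; omega
    exact ⟨hB' _ _ hadj hps hvs n1 n2, by rwa [e7 _ _ hps hvs n1 n2]⟩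
  · have harc : ∀ v ∈ A, v ≠ s → v ≠ r → p v ≠ s → B'.Adj (p v) v → 1 ≤ o (p v) v →
        B.Adj (p v) v ∧ 1 ≤ o' (p v) v := by
      intro v hv hvs hvr hps hadj ho
      by_cases n1 : p v = u ∧ v = t
      · obtain ⟨h, rfl⟩ := n1
        rw [h]
        exact ⟨hmB _ _ h1, e1 ▸ h2⟩
      have n2 : ¬ (p v = t ∧ v = u) := by
        rintro ⟨h, rfl⟩
        have := (harb v (Finset.mem_erase.2 ⟨hvs, hv⟩) hvr).2.2.1
        rw [h] at this; omega
      exact ⟨hB' _ _ hadj hps hvs n1 n2, by rwa [e7 _ _ hps hvs n1 n2]⟩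
    rcases h3 with h3 | h3
    · exact ⟨_, _, o', harb.insert_leaf hu hus (e3 ▸ h3) harc, hdist'⟩
    · exact ⟨_, _, o', harb.insert_leaf ht hst.symm (e5 ▸ h3) harc, hdist'⟩

/-- Adding a vertex of degree two to an arborescence with a token distribution. -/
theorem exists_arborescence_of_degree_two {V : Type*} [DecidableEq V]
    {B B' : SimpleGraph V} {A : Finset V} {m : V → V → ℕ} {g g' : V → ℕ} {r s u t : V}
    (hm : ∀ a b, m a b = m b a) (hmB : ∀ a b, 1 ≤ m a b → B.Adj a b)
    (hms : ∀ a, a ≠ u → a ≠ t → m a s = 0)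
    (hs : s ∈ A) (hu : u ∈ A) (ht : t ∈ A) (hus : B.Adj u s) (hst : B.Adj s t) (hut : u ≠ t)
    (hB' : ∀ a b, B'.Adj a b → a ≠ s → b ≠ s → ¬ (a = u ∧ b = t) → ¬ (a = t ∧ b = u) → B.Adj a b)
    (hg : ∀ a ∈ A, a ≠ s → a ≠ u → a ≠ t → g' a ≤ g a)
    (hgu : m u s - g s + g' u ≤ g u) (hgt : m t s - g s + g' t ≤ g t) (hgs : 1 ≤ g s)
    {p : V → V} {d : V → ℕ} {o : V → V → ℕ} (harb : B'.IsTokenArborescence (A.erase s) r p d o)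
    (hdist : IsTokenDistribution (A.erase s) m g' o)
    (hxy : m u t + (max 1 (m u s + m t s - g s) - (m u s - g s) - (m t s - g s)) ≤
      o u t + o t u) :
    ∃ p d o, B.IsTokenArborescence A r p d o ∧ IsTokenDistribution A m g o := by
  by_cases h1 : t ≠ r ∧ p t = u
  · exact exists_arborescence_of_degree_two_of_arc hm hmB hms hs hu ht hus hst hut hB' hg hgu hgt
      hgs harb hdist hxy h1.1 h1.2
  by_cases h2 : u ≠ r ∧ p u = t
  · refine exists_arborescence_of_degree_two_of_arc hm hmB (fun a h h' => hms a h' h) hs ht hu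
      hst.symm hus.symm hut.symm (fun a b h h1 h2 h3 h4 => hB' a b h h1 h2 h4 h3)
      (fun a h h1 h2 h3 => hg a h h1 h3 h2) hgt hgu hgs harb hdist ?_ h2.1 h2.2
    rw [hm t u, add_comm (m t s)]
    omega
  -- Neither u nor t is the parent of the other, so s can simply be attached as a leaf.
  obtain ⟨aut, atu, aus, asu, ats, ast, hnum, h3⟩ := exists_token_split hgs hxy
  obtain ⟨o', hdist', e1, e2, e3, e4, e5, e6, e7⟩ := exists_tokenDistribution_of_split hm hms hs
    hu ht hus.ne hst.ne' hut hg hgu hgt hdist hnum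
  have harc : ∀ v ∈ A, v ≠ s → v ≠ r → p v ≠ s → B'.Adj (p v) v → 1 ≤ o (p v) v →
      B.Adj (p v) v ∧ 1 ≤ o' (p v) v := by
    intro v hv hvs hvr hps hadj ho
    have n1 : ¬ (p v = u ∧ v = t) := by
      rintro ⟨h, rfl⟩; exact h1 ⟨hvr, h⟩
    have n2 : ¬ (p v = t ∧ v = u) := by
      rintro ⟨h, rfl⟩; exact h2 ⟨hvr, h⟩
    exact ⟨hB' _ _ hadj hps hvs n1 n2, by rwa [e7 _ _ hps hvs n1 n2]⟩
  rcases h3 with h3 | h3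
  · exact ⟨_, _, o', harb.insert_leaf hu hus (e3 ▸ h3) harc, hdist'⟩
  · exact ⟨_, _, o', harb.insert_leaf ht hst.symm (e5 ▸ h3) harc, hdist'⟩

/-! ### Weighted toughness under contraction, and the induction -/

theorem TokenTough.mergeInto_leaf {V : Type*} [DecidableEq V] {B : SimpleGraph V} {A : Finset V}
    {m m' : V → V → ℕ} {g g' : V → ℕ} (h : B.TokenTough A m g) (hm : ∀ a b, m a b = m b a)
    {s u : V} (hs : s ∈ A) (hms : ∀ a, a ≠ u → m a s = 0)
    (hus : B.Adj u s) (hnbr : ∀ b, B.Adj s b → b = u)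
    (hm' : ∀ a b, a ≠ s → b ≠ s → m' a b = m a b)
    (hg' : ∀ a, a ≠ u → g' a = g a) (hgu : max 1 (m u s - g s) + g' u = g u) :
    (B.mergeInto u s).TokenTough (A.erase s) m' g' := by
  intro S hS φ hφ
  have hne : ∀ a ∈ S, a ≠ s := fun a ha => Finset.ne_of_mem_erase (hS ha)
  have hmsum : ∑ a ∈ S, ∑ b ∈ S, m' a b = ∑ a ∈ S, ∑ b ∈ S, m a b :=
    Finset.sum_congr rfl fun a ha => Finset.sum_congr rfl fun b hb =>
      hm' a b (hne a ha) (hne b hb)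
  rw [hmsum]
  have hφB : ∀ a ∈ A.erase s \ S, ∀ b ∈ A.erase s \ S, B.Adj a b → φ a = φ b := by
    intro a ha b hb hab
    exact hφ a ha b hb (hab.mergeInto (Finset.ne_of_mem_erase (Finset.mem_sdiff.1 ha).1)
      (Finset.ne_of_mem_erase (Finset.mem_sdiff.1 hb).1))
  by_cases huS : u ∈ S
  -- The isolated s accounts for the 1 in the maximum, and deleting s too accounts for m u s - g s.
  · have h1 := h.card_succ_le hs hS hφB (fun b hb hab => by
      rw [hnbr b hab] at hb
      exact (Finset.mem_sdiff.1 hb).2 huS)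
    have h2 := h.card_delete_le hm hs (hms s hus.ne') hS hφB
    rw [Finset.sum_eq_single_of_mem u huS fun a _ ha => hms a ha] at h2
    have h3 : ∑ a ∈ S, g a = ∑ a ∈ S, g' a + max 1 (m u s - g s) := by
      have h4 : ∑ a ∈ S.erase u, g' a = ∑ a ∈ S.erase u, g a :=
        Finset.sum_congr rfl fun a ha => hg' a (Finset.ne_of_mem_erase ha)
      rw [← Finset.add_sum_erase S g huS, ← Finset.add_sum_erase S g' huS, h4]
      omega
    rw [if_neg (Finset.ne_empty_of_mem huS)] at h1 ⊢
    omega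
  · have h4 : ∑ a ∈ S, g' a = ∑ a ∈ S, g a :=
      Finset.sum_congr rfl fun a ha => hg' a (by rintro rfl; exact huS ha)
    rw [h4]
    exact h.card_le hs hS hφB (φ u) (fun b _ hab => by rw [hnbr b hab])

theorem sum_sum_ite_eq_and {V : Type*} [DecidableEq V] (S : Finset V) (u t : V) (k : ℕ) :
    ∑ a ∈ S, ∑ b ∈ S, (if a = u ∧ b = t then k else 0) = if u ∈ S ∧ t ∈ S then k else 0 := by
  simp only [ite_and]
  by_cases hu : u ∈ S
  · rw [Finset.sum_eq_single_of_mem u hu fun a _ ha => by simp [ha]]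
    simp [hu]
  · rw [if_neg hu]
    refine Finset.sum_eq_zero fun a ha => ?_
    have : a ≠ u := by rintro rfl; exact hu ha
    simp [this]

theorem TokenTough.mergeInto_degree_two {V : Type*} [DecidableEq V] {B : SimpleGraph V}
    {A : Finset V} {m m' : V → V → ℕ} {g g' : V → ℕ} (h : B.TokenTough A m g)
    (hm : ∀ a b, m a b = m b a) {s u t : V} (hs : s ∈ A) (hu : u ∈ A)
    (hms : ∀ a, a ≠ u → a ≠ t → m a s = 0) (hus : B.Adj u s) (hst : B.Adj s t) (hut : u ≠ t)
    (hnbr : ∀ b, B.Adj s b → b = u ∨ b = t)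
    (hm' : ∀ a b, a ≠ s → b ≠ s → m' a b = m a b +
      (if a = u ∧ b = t then max 1 (m u s + m t s - g s) - (m u s - g s) - (m t s - g s) else 0) +
      (if a = t ∧ b = u then max 1 (m u s + m t s - g s) - (m u s - g s) - (m t s - g s) else 0))
    (hg' : ∀ a, g a = g' a + (if a = u then m u s - g s else 0) +
      if a = t then m t s - g s else 0) :
    (B.mergeInto u s).TokenTough (A.erase s) m' g' := by
  intro S hS φ hφ
  have hne : ∀ a ∈ S, a ≠ s := fun a ha => Finset.ne_of_mem_erase (hS ha)
  rw [Finset.sum_congr rfl fun a ha => Finset.sum_congr rfl fun b hb =>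
    hm' a b (hne a ha) (hne b hb)]
  have hφB : ∀ a ∈ A.erase s \ S, ∀ b ∈ A.erase s \ S, B.Adj a b → φ a = φ b := by
    intro a ha b hb hab
    exact hφ a ha b hb (hab.mergeInto (Finset.ne_of_mem_erase (Finset.mem_sdiff.1 ha).1)
      (Finset.ne_of_mem_erase (Finset.mem_sdiff.1 hb).1))
  have hms0 : m s s = 0 := hms s hus.ne' hst.ne
  have h2 := h.card_delete_le hm hs hms0 hS hφB
  have hsum : ∑ a ∈ S, m a s = (if u ∈ S then m u s else 0) + if t ∈ S then m t s else 0 := by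
    rw [← Finset.sum_ite_eq' S u fun a => m a s, ← Finset.sum_ite_eq' S t fun a => m a s,
      ← Finset.sum_add_distrib]
    refine Finset.sum_congr rfl fun a _ => ?_
    by_cases hau : a = u
    · subst hau; simp [hut]
    · by_cases hat : a = t
      · subst hat; simp [hau]
      · simp [hau, hat, hms a hau hat]
  have hgsum : ∑ a ∈ S, g a = ∑ a ∈ S, g' a + (if u ∈ S then m u s - g s else 0) +
      if t ∈ S then m t s - g s else 0 := by
    rw [Finset.sum_congr rfl fun a _ => hg' a, Finset.sum_add_distrib, Finset.sum_add_distrib,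
      Finset.sum_ite_eq', Finset.sum_ite_eq']
  rw [hsum] at h2
  simp only [Finset.sum_add_distrib, sum_sum_ite_eq_and]
  have hnS : ∀ b ∈ A.erase s \ S, b ∉ S := fun b hb => (Finset.mem_sdiff.1 hb).2
  by_cases huS : u ∈ S
  · rw [if_neg (Finset.ne_empty_of_mem huS)]
    by_cases htS : t ∈ S
    · have h1 := h.card_succ_le hs hS hφB (fun b hb hab => by
        rcases hnbr b hab with rfl | rfl
        exacts [hnS _ hb huS, hnS _ hb htS])
      rw [if_neg (Finset.ne_empty_of_mem huS)] at h1
      simp only [huS, htS, if_true, and_self] at *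
      omega
    · have h1 := h.card_le hs hS hφB (φ t) (fun b hb hab => by
        rcases hnbr b hab with rfl | rfl
        exacts [absurd huS (hnS _ hb), rfl])
      rw [if_neg (Finset.ne_empty_of_mem huS)] at h1
      simp only [huS, htS, if_true, if_false, and_false, false_and] at *
      omega
  · by_cases htS : t ∈ S
    · have h1 := h.card_le hs hS hφB (φ u) (fun b hb hab => by
        rcases hnbr b hab with rfl | rfl
        exacts [rfl, absurd htS (hnS _ hb)])
      rw [if_neg (Finset.ne_empty_of_mem htS)] at h1 ⊢
      simp only [huS, htS, if_true, if_false, and_false, false_and] at *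
      omega
    -- The contraction makes u and t adjacent, so s can take their common label.
    · have h1 := h.card_le hs hS hφB (φ u) (fun b hb hab => by
        rcases hnbr b hab with rfl | rfl
        · rfl
        · exact hφ _ hb _ (Finset.mem_sdiff.2 ⟨Finset.mem_erase.2 ⟨hus.ne, hu⟩, huS⟩)
            ⟨hut.symm, hst.ne', hus.ne, Or.inr (Or.inr ⟨rfl, hst⟩)⟩)
      simp only [huS, htS, if_false, and_false] at *
      omega

theorem exists_tokenArborescence {V : Type*} [DecidableEq V] (n : ℕ) :
    ∀ (B : SimpleGraph V) (A : Finset V) (m : V → V → ℕ) (g : V → ℕ) (r : V), A.card = n →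
      r ∈ A → (∀ a b, B.Adj a b → a ∈ A) → (∀ a b, m a b = m b a) →
      (∀ a b, 1 ≤ m a b → B.Adj a b) → B.IsK4MinorFree → B.TokenTough A m g →
      ∃ p d o, B.IsTokenArborescence A r p d o ∧ IsTokenDistribution A m g o := by
  induction n with
  | zero =>
    intro B A m g r hcard hr
    rw [Finset.card_eq_zero.1 hcard] at hr
    exact absurd hr (Finset.notMem_empty r)
  | succ n ih =>
  intro B A m g r hcard hr hA hm hmB hK4 htough
  have hm0 : ∀ a b, ¬ B.Adj a b → m a b = 0 := fun a b h => by
    by_contra h'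
    exact h (hmB a b (Nat.one_le_iff_ne_zero.2 h'))
  by_cases hne : ∃ v ∈ A, v ≠ r
  swap
  · push Not at hne
    refine ⟨id, fun _ => 0, fun _ _ => 0, fun v hv hvr => absurd (hne v hv) hvr, ?_, ?_⟩
    · intro a ha b hb
      rw [hne a ha, hne b hb, hm0 r r (B.irrefl)]
      exact Nat.zero_le _
    · simp
  obtain ⟨s, hs, hsr, u, t, hut⟩ : ∃ s ∈ A, s ≠ r ∧ B.NbrsInPair s := by
    by_contra hlow
    push Not at hlow
    exact hK4 (isMinor_completeGraph_of_forall_not_nbrsInPair _ B A r rfl hA hr hne hlow)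
  have hrs : r ∈ A.erase s := Finset.mem_erase.2 ⟨hsr.symm, hr⟩
  have hcard' : (A.erase s).card = n := by rw [Finset.card_erase_of_mem hs, hcard]; rfl
  have hconst : ∀ S : Finset V, ∀ a ∈ A.erase s \ S, ∀ b ∈ A.erase s \ S, B.Adj a b →
      (fun _ : V => 0) a = (fun _ : V => 0) b := fun _ _ _ _ _ _ => rfl
  have himg : ((A.erase s \ ∅).image fun _ : V => 0).card = 1 := by
    rw [Finset.sdiff_empty, Finset.image_const ⟨r, hrs⟩, Finset.card_singleton]
  have hms0 : m s s = 0 := hm0 s s B.irrefl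
  -- Delete s alone: at least one component, that of r, remains.
  have hgs : 1 ≤ g s := by
    have := htough.card_delete_le hm hs hms0 (Finset.empty_subset _) (hconst ∅)
    rw [himg] at this
    simpa using this
  have hdel : ∀ v, B.Adj v s → m v s ≤ g v + g s := by
    intro v hv
    have := htough.card_delete_le hm hs hms0 (S := {v})
      (Finset.singleton_subset_iff.2 (Finset.mem_erase.2 ⟨hv.ne, hA _ _ hv⟩)) (hconst {v})
    simp only [Finset.sum_singleton] at this
    omega
  have hedges : ∀ v, B.Adj v s → ∀ a b, (B.mergeInto v s).Adj a b → a ∈ A.erase s := by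
    rintro v hv a b ⟨-, ha, -, h⟩
    refine Finset.mem_erase.2 ⟨ha, ?_⟩
    rcases h with h | ⟨rfl, -⟩ | ⟨-, h⟩
    exacts [hA _ _ h, hA _ _ hv, hA _ _ h.symm]
  have hfree : ∀ v, B.Adj v s → (B.mergeInto v s).IsK4MinorFree :=
    fun v hv h => hK4 (isMinor_completeGraph_of_mergeInto hv h)
  have hdegree : (∃ u, B.Adj u s ∧ ∀ b, B.Adj s b → b = u) ∨
      ∃ u t, u ≠ t ∧ B.Adj u s ∧ B.Adj s t ∧ ∀ b, B.Adj s b → b = u ∨ b = t := by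
    by_cases hu : B.Adj s u
    · by_cases ht : B.Adj s t ∧ u ≠ t
      · exact Or.inr ⟨u, t, ht.2, hu.symm, ht.1, hut⟩
      · refine Or.inl ⟨u, hu.symm, fun b hb => ?_⟩
        rcases hut b hb with h | rfl
        · exact h
        · by_contra hne
          exact ht ⟨hb, Ne.symm hne⟩
    · by_cases ht : B.Adj s t
      · refine Or.inl ⟨t, ht.symm, fun b hb => ?_⟩
        rcases hut b hb with rfl | h
        exacts [absurd hb hu, h]
      -- With S empty only one component is allowed, but an isolated s would be a second one.
      · have := htough.card_succ_le hs (Finset.empty_subset _) (hconst ∅) (fun b _ hb => by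
          rcases hut b hb with rfl | rfl <;> contradiction)
        rw [himg] at this
        simp at this
  rcases hdegree with ⟨u, hus, hnbr⟩ | ⟨u, t, hut, hus, hst, hnbr⟩
  · have hms : ∀ a, a ≠ u → m a s = 0 := fun a ha => hm0 a s fun h => ha (hnbr a h.symm)
    have huA := hA _ _ hus
    have hgu : max 1 (m u s - g s) ≤ g u := by
      have h1 := hdel u hus
      have h2 := htough.card_succ_le hs (S := {u})
        (Finset.singleton_subset_iff.2 (Finset.mem_erase.2 ⟨hus.ne, huA⟩)) (hconst {u})
        (fun b hb hab => by
          rw [hnbr b hab] at hb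
          simp at hb)
      rw [if_neg (Finset.singleton_ne_empty u)] at h2
      simp only [Finset.sum_singleton] at h2
      omega
    obtain ⟨p, d, o, harb, hdist⟩ := ih (B.mergeInto u s) (A.erase s)
      -- The demand at s is set to zero because s has no edges left to carry it.
      (fun a b => if a = s ∨ b = s then 0 else m a b)
      (fun a => if a = u then g u - max 1 (m u s - g s) else g a) r hcard' hrs (hedges u hus)
      (fun a b => by simp only [hm a b, or_comm])
      (fun a b h => by
        split_ifs at h with hab
        · omega
        · rw [not_or] at hab
          exact (hmB a b h).mergeInto hab.1 hab.2)
      (hfree u hus)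
      (htough.mergeInto_leaf hm hs hms hus hnbr (fun a b ha hb => by simp [ha, hb])
        (fun a ha => by simp [ha]) (by simp only [if_true]; omega))
    refine exists_arborescence_of_leaf hm hms hs huA hus hsr ?_ (fun a _ _ ha => ?_) ?_ harb
      ⟨fun a ha b hb => ?_, hdist.2⟩
    · rintro a b ⟨hab, -, -, h | ⟨h1, h2⟩ | ⟨h1, h2⟩⟩ _ _
      · exact h
      · exact absurd (h1.trans (hnbr b h2).symm) hab
      · exact absurd ((hnbr a h2).trans h1.symm) hab
    · simp [ha]
    · simp only [if_true]; omega
    · have := hdist.1 a ha b hb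
      beta_reduce at this
      rwa [if_neg (not_or.2 ⟨Finset.ne_of_mem_erase ha, Finset.ne_of_mem_erase hb⟩)] at this
  · have hms : ∀ a, a ≠ u → a ≠ t → m a s = 0 := fun a ha ha' => hm0 a s fun h => by
      rcases hnbr a h.symm with h | h <;> contradiction
    have huA := hA _ _ hus
    have htA := hA _ _ hst.symm
    have hgu := hdel u hus
    have hgt := hdel t hst.symm
    have hm'' : ∀ (a b : V) (k l : ℕ), 1 ≤ m a b + (if a = u ∧ b = t then k else 0) +
        (if a = t ∧ b = u then l else 0) → a ≠ s → b ≠ s → (B.mergeInto u s).Adj a b := by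
      intro a b k l h ha hb
      by_cases h1 : a = u ∧ b = t
      · obtain ⟨rfl, rfl⟩ := h1
        exact ⟨hut, ha, hb, Or.inr (Or.inl ⟨rfl, hst⟩)⟩
      by_cases h2 : a = t ∧ b = u
      · obtain ⟨rfl, rfl⟩ := h2
        exact ⟨hut.symm, ha, hb, Or.inr (Or.inr ⟨rfl, hst⟩)⟩
      rw [if_neg h1, if_neg h2] at h
      exact (hmB a b h).mergeInto ha hb
    obtain ⟨p, d, o, harb, hdist⟩ := ih (B.mergeInto u s) (A.erase s)
      (fun a b => if a = s ∨ b = s then 0 else m a b +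
        (if a = u ∧ b = t then
          max 1 (m u s + m t s - g s) - (m u s - g s) - (m t s - g s) else 0) +
        (if a = t ∧ b = u then
          max 1 (m u s + m t s - g s) - (m u s - g s) - (m t s - g s) else 0))
      (fun a => g a - (if a = u then m u s - g s else 0) - if a = t then m t s - g s else 0)
      r hcard' hrs (hedges u hus)
      (fun a b => by
        simp only [hm a b, or_comm (a := a = s), and_comm (a := a = u), and_comm (a := a = t)]
        rw [add_right_comm])
      (fun a b h => by
        by_cases hab : a = s ∨ b = s
        · rw [if_pos hab] at h; omega
        · rw [if_neg hab] at h
          rw [not_or] at hab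
          exact hm'' a b _ _ h hab.1 hab.2)
      (hfree u hus)
      (htough.mergeInto_degree_two hm hs huA hms hus hst hut hnbr (fun a b ha hb => by simp [ha, hb])
        (fun a => by
          by_cases hau : a = u
          · subst hau; simp only [if_true, hut, if_false]; omega
          by_cases hat : a = t
          · subst hat; simp only [if_true, hau, if_false]; omega
          · simp [hau, hat]))
    have hdist' : ∀ a ∈ A.erase s, ∀ b ∈ A.erase s, m a b +
        (if a = u ∧ b = t then
          max 1 (m u s + m t s - g s) - (m u s - g s) - (m t s - g s) else 0) +
        (if a = t ∧ b = u then
          max 1 (m u s + m t s - g s) - (m u s - g s) - (m t s - g s) else 0) ≤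
        o a b + o b a := by
      intro a ha b hb
      have := hdist.1 a ha b hb
      beta_reduce at this
      rwa [if_neg (not_or.2 ⟨Finset.ne_of_mem_erase ha, Finset.ne_of_mem_erase hb⟩)] at this
    refine exists_arborescence_of_degree_two hm hmB hms hs huA htA hus hst hut ?_
      (fun a _ _ hau hat => ?_) ?_ ?_ hgs harb ⟨fun a ha b hb => ?_, hdist.2⟩ ?_
    · rintro a b ⟨hab, -, -, h | ⟨h1, h2⟩ | ⟨h1, h2⟩⟩ _ _ n1 n2
      · exact h
      · rcases hnbr b h2 with h | h
        · exact absurd (h1.trans h.symm) hab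
        · exact absurd ⟨h1, h⟩ n1
      · rcases hnbr a h2 with h | h
        · exact absurd (h.trans h1.symm) hab
        · exact absurd ⟨h, h1⟩ n2
    · simp [hau, hat]
    · simp only [if_true, hut, if_false]; omega
    · simp only [if_true, hut.symm, if_false]; omega
    · have := hdist' a ha b hb
      omega
    · have := hdist' u (Finset.mem_erase.2 ⟨hus.ne, huA⟩) t (Finset.mem_erase.2 ⟨hst.ne', htA⟩)
      simpa [hut] using this

/-! ### From the weighted statement to trees and walks -/

theorem IsTough.tokenTough {V : Type*} [Fintype V] [DecidableEq V] {G : SimpleGraph V} {k : ℕ}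
    (hk : 2 ≤ k) (hconn : G.Connected) (h : G.IsTough (1 / ((k : ℝ) - 1))) :
    G.TokenTough Finset.univ (fun _ _ => 0) (fun _ => k - 1) := by
  intro S _ φ hφ
  simp only [Finset.sum_const_zero, Finset.sum_const, smul_eq_mul, zero_add]
  by_cases hS : S = ∅
  · subst hS
    have hall : ∀ a b, φ a = φ b := by
      intro a b
      obtain ⟨w⟩ := hconn.preconnected a b
      induction w with
      | nil => rfl
      | cons hadj _ ih => rw [← ih]; exact hφ _ (by simp) _ (by simp) hadj
    have : ((Finset.univ \ ∅ : Finset V).image φ).card ≤ 1 := by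
      refine Finset.card_le_one.2 fun x hx y hy => ?_
      obtain ⟨a, -, rfl⟩ := Finset.mem_image.1 hx
      obtain ⟨b, -, rfl⟩ := Finset.mem_image.1 hy
      exact hall a b
    rw [if_pos rfl]
    omega
  rw [if_neg hS]
  have hle : ((Finset.univ \ S).image φ).card ≤ G.numComponentsDelete S := by
    have hS' : ∀ v : ((S : Set V)ᶜ : Set V), (v : V) ∈ Finset.univ \ S := fun v =>
      Finset.mem_sdiff.2 ⟨Finset.mem_univ _, v.2⟩
    have hlift : ∀ (v w : ((S : Set V)ᶜ : Set V)) (q : (G.induce ((S : Set V)ᶜ)).Walk v w),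
        q.IsPath → φ v = φ w := by
      intro v w q _
      induction q with
      | nil => rfl
      | @cons a b _ hadj _ ih =>
        exact (hφ _ (hS' a) _ (hS' b) hadj).trans (ih (by simp_all))
    -- Being constant on components, φ factors through them and takes at most c(G - S) values.
    let ψ : (G.induce ((S : Set V)ᶜ)).ConnectedComponent → ℕ :=
      ConnectedComponent.lift (fun v => φ v) hlift
    have hsub : (((Finset.univ \ S).image φ : Finset ℕ) : Set ℕ) ⊆ Set.range ψ := by
      intro x hx
      obtain ⟨a, ha, rfl⟩ := Finset.mem_image.1 (Finset.mem_coe.1 hx)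
      have ha' : a ∈ ((S : Set V)ᶜ : Set V) := by simpa using ha
      exact ⟨(G.induce ((S : Set V)ᶜ)).connectedComponentMk ⟨a, ha'⟩, rfl⟩
    calc ((Finset.univ \ S).image φ).card
        = (((Finset.univ \ S).image φ : Finset ℕ) : Set ℕ).ncard :=
          (Set.ncard_coe_finset _).symm
      _ ≤ (Set.range ψ).ncard := Set.ncard_le_ncard hsub (Set.finite_range ψ)
      _ ≤ G.numComponentsDelete S := by
          rw [← Set.image_univ, numComponentsDelete, ← Set.ncard_univ]
          exact Set.ncard_image_le Set.finite_univ
  have hpos : 1 ≤ S.card := Finset.card_pos.2 (Finset.nonempty_iff_ne_empty.2 hS)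
  have hkey : G.numComponentsDelete S ≤ S.card * (k - 1) := by
    by_cases h2 : 2 ≤ G.numComponentsDelete S
    · have h3 := h S h2
      have hk' : (0 : ℝ) < (k : ℝ) - 1 := by
        have : (2 : ℝ) ≤ k := by exact_mod_cast hk
        linarith
      rw [one_div, inv_mul_le_iff₀ hk'] at h3
      have h4 : ((k - 1 : ℕ) : ℝ) = (k : ℝ) - 1 := by
        rw [Nat.cast_sub (by omega), Nat.cast_one]
      rw [← h4, mul_comm] at h3
      exact_mod_cast h3
    · have : 1 * 1 ≤ S.card * (k - 1) := Nat.mul_le_mul hpos (by omega)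
      omega
  omega

/-- The graph of a parent function `p` with root `r`. -/
def parentGraph {V : Type*} (r : V) (p : V → V) : SimpleGraph V where
  Adj a b := a ≠ b ∧ ((a ≠ r ∧ p a = b) ∨ (b ≠ r ∧ p b = a))
  symm := ⟨fun _ _ h => ⟨h.1.symm, h.2.symm⟩⟩
  loopless := ⟨fun _ h => h.1 rfl⟩

theorem isTree_parentGraph {V : Type*} [Fintype V] [DecidableEq V] {r : V} {p : V → V}
    {d : V → ℕ} (hd : ∀ v, v ≠ r → d (p v) < d v) : (parentGraph r p).IsTree := by
  have hadj : ∀ v, v ≠ r → (parentGraph r p).Adj v (p v) := by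
    intro v hv
    refine ⟨fun h => ?_, Or.inl ⟨hv, rfl⟩⟩
    have := hd v hv
    rw [← h] at this
    omega
  have hreach : ∀ n v, d v = n → (parentGraph r p).Reachable r v := by
    intro n
    induction n using Nat.strong_induction_on with
    | _ n ih =>
      intro v hv
      by_cases hvr : v = r
      · rw [hvr]
      · exact (ih _ (hv ▸ hd v hvr) _ rfl).trans (hadj v hvr).symm.reachable
  have hconn : (parentGraph r p).Connected :=
    (connected_iff_exists_forall_reachable _).2 ⟨r, fun v => hreach _ v rfl⟩
  rw [isTree_iff_connected_and_card]
  refine ⟨hconn, le_antisymm ?_ hconn.card_vert_le_card_edgeSet_add_one⟩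
  -- Each edge joins a non-root vertex to its parent, so there are at most |V| - 1 edges.
  have hsub : (parentGraph r p).edgeSet ⊆
      ((Finset.univ.erase r).image fun v => s(v, p v) : Finset (Sym2 V)) := by
    intro e
    induction e using Sym2.ind with
    | _ a b =>
      rw [mem_edgeSet, Finset.mem_coe, Finset.mem_image]
      rintro ⟨-, ⟨h1, h2⟩ | ⟨h1, h2⟩⟩
      · exact ⟨a, by simpa using h1, by rw [h2]⟩
      · exact ⟨b, by simpa using h1, by rw [h2, Sym2.eq_swap]⟩
  have h1 := Set.ncard_le_ncard hsub (Finset.finite_toSet _)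
  rw [Set.ncard_coe_finset] at h1
  have h2 := Finset.card_image_le (s := Finset.univ.erase r) (f := fun v => s(v, p v))
  rw [Finset.card_erase_of_mem (Finset.mem_univ r), Finset.card_univ] at h2
  have h3 : 0 < Fintype.card V := Fintype.card_pos_iff.2 ⟨r⟩
  rw [Nat.card_eq_fintype_card (α := V), Nat.card_coe_set_eq]
  omega

/-- Each child of v uses up a token of v, and v has at most g v of them. -/
theorem card_children_le {V : Type*} [Fintype V] [DecidableEq V] {G : SimpleGraph V} {r : V}
    {p : V → V} {d : V → ℕ} {o m : V → V → ℕ} {g : V → ℕ}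
    (harb : G.IsTokenArborescence Finset.univ r p d o)
    (hdist : IsTokenDistribution Finset.univ m g o) (v : V) :
    ((Finset.univ.erase r).filter fun w => p w = v).card ≤ g v := by
  refine le_trans ?_ (hdist.2 v (Finset.mem_univ v))
  rw [Finset.card_eq_sum_ones]
  refine le_trans (Finset.sum_le_sum fun w hw => ?_)
    (Finset.sum_le_sum_of_subset (f := o v) (Finset.subset_univ _))
  rw [Finset.mem_filter, Finset.mem_erase] at hw
  have := (harb w (Finset.mem_univ w) hw.1.1).2.2.2
  rwa [hw.2] at this

/-- An arborescence has a closed walk that visits each vertex at most once for each of its children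
and, unless it is the root, once more. -/
theorem exists_closed_walk {V : Type*} [DecidableEq V] {G : SimpleGraph V} {r : V} {p : V → V}
    {d : V → ℕ} (s : Finset V) (hr : r ∉ s) (hs : ∀ v ∈ s, p v ∈ insert r s)
    (hadj : ∀ v ∈ s, G.Adj (p v) v) (hd : ∀ v ∈ s, d (p v) < d v) :
    ∃ w : G.Walk r r, (∀ v ∈ insert r s, v ∈ w.support) ∧
      ∀ v, w.support.tail.count v ≤ (s.filter fun x => p x = v).card + if v ∈ s then 1 else 0 := by
  induction s using Finset.induction_on_max_value d with
  | empty => exact ⟨Walk.nil, by simp, by simp⟩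
  | insert a s ha hmax ih =>
    -- As a has maximal rank, it is nobody's parent and s is closed under parents up to r. The
    -- detour p a, a, p a adds one visit to a and one to p a.
    obtain ⟨w, hw, hcount⟩ := ih (fun h => hr (Finset.mem_insert_of_mem h))
      (fun v hv => by
        have h1 := hs v (Finset.mem_insert_of_mem hv)
        have h2 := hd v (Finset.mem_insert_of_mem hv)
        have h3 := hmax v hv
        rw [Finset.mem_insert, Finset.mem_insert] at h1
        rw [Finset.mem_insert]
        rcases h1 with h | h | h
        · exact Or.inl h
        · rw [h] at h2; omega
        · exact Or.inr h)
      (fun v hv => hadj v (Finset.mem_insert_of_mem hv))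
      (fun v hv => hd v (Finset.mem_insert_of_mem hv))
    have hpa : p a ∈ w.support := by
      apply hw
      have h1 := hs a (Finset.mem_insert_self a s)
      have h2 := hd a (Finset.mem_insert_self a s)
      rw [Finset.mem_insert, Finset.mem_insert] at h1
      rw [Finset.mem_insert]
      rcases h1 with h | h | h
      · exact Or.inl h
      · rw [h] at h2; omega
      · exact Or.inr h
    have hea := hadj a (Finset.mem_insert_self a s)
    have hspec := w.take_spec hpa
    refine ⟨((w.takeUntil _ hpa).append (Walk.cons hea (Walk.cons hea.symm Walk.nil))).append
      (w.dropUntil _ hpa), fun v hv => ?_, fun v => ?_⟩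
    · simp only [Walk.mem_support_append_iff]
      rw [Finset.mem_insert, Finset.mem_insert] at hv
      have h1 : v = a ∨ v ∈ w.support := by
        rcases hv with h | h | h
        · exact Or.inr (hw v (Finset.mem_insert.2 (Or.inl h)))
        · exact Or.inl h
        · exact Or.inr (hw v (Finset.mem_insert.2 (Or.inr h)))
      rcases h1 with rfl | h
      · simp
      · rw [← hspec, Walk.mem_support_append_iff] at h
        tauto
    · have h1 := hcount v
      rw [← hspec, Walk.tail_support_append, List.count_append] at h1
      rw [Walk.tail_support_append, Walk.tail_support_append, List.count_append,
        List.count_append]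
      simp only [Walk.support_cons, Walk.support_nil, List.tail_cons, List.count_cons,
        List.count_nil, beq_iff_eq]
      rw [Finset.filter_insert]
      have hva : v = a → v ∉ s := by rintro rfl; exact ha
      have hpv : (if p a = v then insert a (s.filter fun x => p x = v) else
          s.filter fun x => p x = v).card =
          (s.filter fun x => p x = v).card + if p a = v then 1 else 0 := by
        split_ifs
        · rw [Finset.card_insert_of_notMem (by simp [ha])]
        · rfl
      rw [hpv]
      simp only [Finset.mem_insert]
      by_cases h2 : a = v
      · subst h2
        simp only [ha, if_true, if_false, true_or] at h1 ⊢
        omega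
      · simp only [h2, Ne.symm h2, if_false, false_or] at h1 ⊢
        omega

end SimpleGraph
theorem mainTheorem2 {V : Type*} [Fintype V] [DecidableEq V] (G : SimpleGraph V)
    (k : ℕ) (hk : 2 ≤ k) (hconn : G.Connected) (hK4 : G.IsK4MinorFree)
    (htough : G.IsTough (1 / ((k : ℝ) - 1))) :
    (∀ x : V, ∃ (T : SimpleGraph V) (_ : DecidableRel T.Adj),
      T.IsSpanningTree G ∧ (∀ v, T.degree v ≤ k) ∧ T.degree x ≤ k - 1) ∧
    (∃ (T : SimpleGraph V) (_ : DecidableRel T.Adj), T.IsSpanningTree G ∧ T.IsKTree k) ∧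
    (∃ (u : V) (p : G.Walk u u), p.IsSpanningWalk ∧ p.IsKWalk k) := by
  classical
  have hmain := fun r => SimpleGraph.exists_tokenArborescence _ G Finset.univ (fun _ _ => 0)
    (fun _ => k - 1) r rfl (Finset.mem_univ r) (fun a _ _ => Finset.mem_univ a) (fun _ _ => rfl)
    (fun _ _ h => absurd h (by simp)) hK4 (htough.tokenTough hk hconn)
  have htree : ∀ x : V, ∃ (T : SimpleGraph V) (_ : DecidableRel T.Adj),
      T.IsSpanningTree G ∧ (∀ v, T.degree v ≤ k) ∧ T.degree x ≤ k - 1 := by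
    intro x
    obtain ⟨p, d, o, harb, hdist⟩ := hmain x
    have hpar := fun v hv => harb v (Finset.mem_univ v) hv
    refine ⟨SimpleGraph.parentGraph x p, Classical.decRel _, ⟨?_,
      SimpleGraph.isTree_parentGraph (d := d) fun v hv => (hpar v hv).2.2.1⟩, fun v => ?_, ?_⟩
    · rintro a b ⟨-, ⟨h1, h2⟩ | ⟨h1, h2⟩⟩
      · exact h2 ▸ (hpar a h1).2.1.symm
      · exact h2 ▸ (hpar b h1).2.1
    · have h1 := SimpleGraph.card_children_le harb hdist v
      rw [← SimpleGraph.card_neighborFinset_eq_degree]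
      -- The neighbours of v are its children and at most one parent.
      refine le_trans (Finset.card_le_card (t := insert (p v)
        ((Finset.univ.erase x).filter fun w => p w = v)) fun w hw => ?_)
        ((Finset.card_insert_le _ _).trans (by omega))
      rw [SimpleGraph.mem_neighborFinset] at hw
      rcases hw with ⟨-, ⟨-, h⟩ | ⟨h, h'⟩⟩ <;> simp [*]
    · have h1 := SimpleGraph.card_children_le harb hdist x
      rw [← SimpleGraph.card_neighborFinset_eq_degree]
      refine le_trans (Finset.card_le_card fun w hw => ?_) h1
      rw [SimpleGraph.mem_neighborFinset] at hw
      rcases hw with ⟨-, ⟨h, -⟩ | ⟨h, h'⟩⟩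
      · exact absurd rfl h
      · simp [h, h']
  obtain ⟨r⟩ := hconn.nonempty
  refine ⟨htree, ?_, ?_⟩
  · obtain ⟨T, hdec, hT, hdeg, -⟩ := htree r
    exact ⟨T, hdec, hT, hT.2, hdeg⟩
  · obtain ⟨p, d, o, harb, hdist⟩ := hmain r
    have hpar := fun v (hv : v ∈ Finset.univ.erase r) =>
      harb v (Finset.mem_univ v) (Finset.ne_of_mem_erase hv)
    obtain ⟨w, hw, hcount⟩ := SimpleGraph.exists_closed_walk (d := d) (Finset.univ.erase r)
      (Finset.notMem_erase r _) (fun v _ => by simp)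
      (fun v hv => (hpar v hv).2.1) (fun v hv => (hpar v hv).2.2.1)
    refine ⟨r, w, fun v => hw v (by simp), fun v => (hcount v).trans ?_⟩
    have h1 := SimpleGraph.card_children_le harb hdist v
    split_ifs <;> omega
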